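/- **Definitions.** Let $(X,\rho)$ be a metric space and $f:X\to X$ a map; $f^n$ is the $n$-th iterate ($f^0=\mathrm{id}$). $f$ is *transitive* if for all nonempty open $U,V$ there is $k\ge 1$ with $f^k(U)\cap V\neq\emptyset$, and *weakly mixing* if $f\times f$ is transitive on $X\times X$. A point $x$ is *totally transitive* if for every $n\ge 1$ its orbit $\{f^{ni}(x):i\ge 0\}$ under $f^n$ is dense. A *Cantor set* is a nonempty compact, perfect, totally disconnected set. Let $M$ be an infinite set of positive integers. A set $C$ is *$M$-synchronously proximal* to $v$ if there is a strictly increasing sequence $(m_i)$ in $M$ with $\mathrm{diam}(f^{m_i}(C)\cup\{v\})\to 0$; it is *dynamically synchronously proximal* to $v$ if there is a strictly increasing sequence $(n_i)$ of positive integers with $\mathrm{diam}(f^{n_i}(C\cup\{v\}))\to 0$. For $0<\beta\le\infty$, a set $S$ with at least two points is *$\beta$-scrambled* for $f$ if for all distinct $x,y\in S$ $$\liminf_{n\to\infty}\rho(f^n(x),f^n(y))=0,\qquad \limsup_{n\to\infty}\rho(f^n(x),f^n(y))\ge\beta$$ ($=\infty$ if $\beta=\infty$); it is *$\beta$-scrambled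 with respect to $M$* if the same holds with both limits taken along $n\in M$; it is *scrambled* if for all distinct $x,y\in S$ the $\liminf$ is $0$ and the $\limsup$ is $>0$. A set $A$ is *invariant* under $f$ if $f(A)\subseteq A$. **Theorem.** Let $(X,\rho)$ be an infinite separable locally compact metric space and $f:X\to X$ a continuous weakly mixing map. Let $\beta=\sup_{x,y\in X}\rho(x,y)$ (so $\beta=\mathrm{diam}(X)$ if $X$ is bounded, $\beta=\infty$ otherwise), and $\delta=\inf_{n\ge1}\sup_{x\in X}\rho(f^n(x),x)\in[0,\infty]$. Let $V\subseteq X$ be a countable set (finite or infinite), and let $P\subseteq X$ be a countable (possibly finite or empty) set of points whose orbits under $f$ have compact closures. Then $X$ has no isolated points, and there exist an infinite set $M$ of positive integers and countably infinitely many pairwise disjoint Cantor sets $S^{(1)},S^{(2)},\dots$ of totally transitive points of $f$ such that for each $n\ge1$ the number $n!$ divides all sufficiently large elements of $M$ and, with $\mathbb S=\bigcup_{j\ge1}S^{(j)}$ and $\widehat{\mathbb S}=\bigcup_{i\ge0}f^i(\mathbb S)$: 1. each nonempty open subset of $X$ contains infinitely many of the sets $S^{(j)}$; 2. for each $\ell\ge1$,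 the set $\bigcup_{j=1}^{\ell}S^{(j)}$ is $M$-synchronously proximal to each $v\in V$ and dynamically synchronously proximal to $f^i(x)$ for each $x\in P$ and each $i\ge0$; 3. $\mathbb S$ is dense and $\beta$-scrambled with respect to $M$ for $f$, and it is $\beta$-scrambled for $f^n$ for each $n\ge1$; 4. for all $x\in\bigcup_{i\ge0}f^i(P)$ and all $c\in\widehat{\mathbb S}$, $\liminf_{n\to\infty}\rho(f^n(x),f^n(c))=0$ and $\limsup_{n\to\infty}\rho(f^n(x),f^n(c))\ge\beta/2$, i.e. $\{x,c\}$ is a $(\beta/2)$-scrambled set of $f$; 5. for all $c\neq d$ in $\mathbb S$ and all $i\ge0$, $\limsup_{n\to\infty,\,n\in M}\rho(f^n(f^i(c)),f^n(f^i(d)))=\beta$. Moreover, these sets $M$ and $S^{(j)}$ can be chosen so that, in addition to all of the above: 6. if $f$ has a fixed point, then $\widehat{\mathbb S}$ is dense and, for each $n\ge1$, it is an invariant scrambled set of $f^n$; 7. if $f$ has a fixed point and $\delta>0$ (that is, $f$ is not uniformly rigid), then $\widehat{\mathbb S}$ is dense and, for each $n\ge1$, it is an invariant $\delta$-scrambled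 set of $f^n$. -/

import Mathlib

open Set Filter Topology
open scoped ENNReal

namespace TopDyn

/-- The orbit `{f^i(x) : i = 0, 1, 2, …}` of the point `x`. -/
def orbit {X : Type*} (f : X → X) (x : X) : Set X := Set.range fun i : ℕ => f^[i] x

/-- Topological transitivity: for nonempty open `U`, `V` some `k > 0` has `f^k(U) ∩ V ≠ ∅`. -/
def IsTransitive {X : Type*} [TopologicalSpace X] (f : X → X) : Prop :=
  ∀ U V : Set X, IsOpen U → U.Nonempty → IsOpen V → V.Nonempty →
    ∃ k : ℕ, 0 < k ∧ (f^[k] '' U ∩ V).Nonempty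

/-- `f` is weakly mixing if `f × f` is transitive on `X × X`. -/
def IsWeaklyMixing {X : Type*} [TopologicalSpace X] (f : X → X) : Prop :=
  IsTransitive (Prod.map f f)

/-- `x` is a transitive point of `f` if its orbit is dense. -/
def IsTransitivePoint {X : Type*} [TopologicalSpace X] (f : X → X) (x : X) : Prop :=
  Dense (orbit f x)

/-- `x` is a totally transitive point of `f` if it is a transitive point of every `f^n`, `n ≥ 1`. -/
def IsTotallyTransitivePoint {X : Type*} [TopologicalSpace X] (f : X → X) (x : X) : Prop :=
  ∀ n : ℕ, 1 ≤ n → IsTransitivePoint (f^[n]) x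

/-- A Cantor set: nonempty, compact, perfect and totally disconnected. -/
def IsCantorSet {X : Type*} [TopologicalSpace X] (C : Set X) : Prop :=
  C.Nonempty ∧ IsCompact C ∧ Perfect C ∧ IsTotallyDisconnected C

/-- `C` is `M`-synchronously proximal to `v`: the diameters of `f^{m_i}(C) ∪ {v}` tend to `0` along
some strictly increasing sequence of positive integers `m_i ∈ M`. The diameter is the
extended one, which is `∞` for an unbounded set. -/
def IsSyncProximalWrt {X : Type*} [MetricSpace X] (f : X → X) (M : Set ℕ)
    (C : Set X) (v : X) : Prop :=
  ∃ m : ℕ → ℕ, StrictMono m ∧ (∀ i, 0 < m i ∧ m i ∈ M) ∧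
    Tendsto (fun i => Metric.ediam (f^[m i] '' C ∪ {v})) atTop (𝓝 0)

/-- `C` is dynamically synchronously proximal to `v`: the diameters of `f^{n_i}(C ∪ {v})` tend to
`0` along some strictly increasing sequence of positive integers `n_i`. -/
def IsDynSyncProximal {X : Type*} [MetricSpace X] (f : X → X) (C : Set X) (v : X) : Prop :=
  ∃ k : ℕ → ℕ, StrictMono k ∧ (∀ i, 0 < k i) ∧
    Tendsto (fun i => Metric.ediam (f^[k i] '' (C ∪ {v}))) atTop (𝓝 0)

/-- `β`-scrambled set of `f`, for `0 < β ≤ ∞`. Distances are read in `[0, ∞]`, so that for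
`β = ∞` the second condition says that the upper limit equals `∞`. -/
def IsScrambledSet {X : Type*} [MetricSpace X] (f : X → X) (β : ℝ≥0∞) (S : Set X) : Prop :=
  0 < β ∧ S.Nontrivial ∧ ∀ x ∈ S, ∀ y ∈ S, x ≠ y →
    liminf (fun n : ℕ => edist (f^[n] x) (f^[n] y)) atTop = 0 ∧
    β ≤ limsup (fun n : ℕ => edist (f^[n] x) (f^[n] y)) atTop

/-- `β`-scrambled set of `f` with respect to `M`: the limits are taken along `n ∈ M`. -/
def IsScrambledSetWrt {X : Type*} [MetricSpace X] (f : X → X) (M : Set ℕ) (β : ℝ≥0∞)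
    (S : Set X) : Prop :=
  0 < β ∧ S.Nontrivial ∧ ∀ x ∈ S, ∀ y ∈ S, x ≠ y →
    liminf (fun n : ℕ => edist (f^[n] x) (f^[n] y)) (atTop ⊓ 𝓟 M) = 0 ∧
    β ≤ limsup (fun n : ℕ => edist (f^[n] x) (f^[n] y)) (atTop ⊓ 𝓟 M)

/-- Scrambled set of `f` in the sense of Li and Yorke: the upper limit is only required to be
positive, with no uniform lower bound. -/
def IsLiYorkeScrambledSet {X : Type*} [MetricSpace X] (f : X → X) (S : Set X) : Prop :=
  S.Nontrivial ∧ ∀ x ∈ S, ∀ y ∈ S, x ≠ y →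
    liminf (fun n : ℕ => edist (f^[n] x) (f^[n] y)) atTop = 0 ∧
    0 < limsup (fun n : ℕ => edist (f^[n] x) (f^[n] y)) atTop

/-- `⋃_{i ≥ 0} f^i(A)`. -/
def forwardUnion {X : Type*} (f : X → X) (A : Set X) : Set X := ⋃ i : ℕ, f^[i] '' A

/-- The number `β`: the supremum of all distances in `X`, as an element of `[0, ∞]`; it is
`diam X` if `X` is bounded, and `∞` if `X` is unbounded. -/
noncomputable def spaceDiam (X : Type*) [MetricSpace X] : ℝ≥0∞ := ⨆ (x : X) (y : X), edist x y

/-- The number `δ = inf_{n ≥ 1} sup_{x ∈ X} ρ(f^n(x), x)`, as an element of `[0, ∞]`. -/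
noncomputable def rigidityConst {X : Type*} [MetricSpace X] (f : X → X) : ℝ≥0∞ :=
  ⨅ (n : ℕ) (_ : 1 ≤ n), ⨆ x : X, edist (f^[n] x) x

end TopDyn

open TopDyn

/-! The Cantor sets are found by Baire category. A separable locally compact metric space is Polish,
so sequences `φ` of continuous maps from the Cantor space to `X` form a Baire space, and `S j` is
the range of `φ j` for a generic `φ`.

Weak mixing makes any finite family of hitting time sets contain a common hitting time set, with
arbitrarily large elements divisible by a given `d` (`IsWeaklyMixing.exists_common`,
`IsWeaklyMixing.exists_dvd_time`). Near any `φ` there is hence a sequence of maps, each constant on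
cylinders, whose pieces on finitely many levels reach arbitrary open targets at one common time
(`eventually_residual_exists_time`). Only countably many finite itineraries in a countable basis
matter, so a generic `φ` realizes them all, and `M` collects suitable times (`IsGenericFamily`).
Equal targets give proximality and transitivity, targets far apart give separation, and divisibility
by factorials passes both to `f^n`.

For a point of `P` the target must move with its orbit. Compactness of the orbit closure lets
finitely many small balls serve as targets, and the farther of two sets nearly `β` apart is always
about `β / 2` away (`exists_selectors`). Shifts of one point along its orbit cannot be steered
independently; for them the displacement of an iterate of `f` gives `δ`, and a fixed point gives
proximality. -/

namespace TopDyn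

/-! ### Hitting times of weakly mixing maps -/

section WeakMixing

variable {X : Type*} [TopologicalSpace X] {f : X → X}

theorem IsWeaklyMixing.exists_pair (hmix : IsWeaklyMixing f) {U₁ V₁ U₂ V₂ : Set X}
    (hU₁ : IsOpen U₁) (hU₁' : U₁.Nonempty) (hV₁ : IsOpen V₁) (hV₁' : V₁.Nonempty)
    (hU₂ : IsOpen U₂) (hU₂' : U₂.Nonempty) (hV₂ : IsOpen V₂) (hV₂' : V₂.Nonempty) :
    ∃ k : ℕ, 0 < k ∧ (U₁ ∩ f^[k] ⁻¹' V₁).Nonempty ∧ (U₂ ∩ f^[k] ⁻¹' V₂).Nonempty := by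
  obtain ⟨k, hk, q, ⟨⟨a, b⟩, ⟨ha, hb⟩, rfl⟩, hq⟩ := hmix (U₁ ×ˢ U₂) (V₁ ×ˢ V₂) (hU₁.prod hU₂)
    (hU₁'.prod hU₂') (hV₁.prod hV₂) (hV₁'.prod hV₂')
  rw [Prod.map_iterate] at hq
  exact ⟨k, hk, ⟨a, ha, hq.1⟩, ⟨b, hb, hq.2⟩⟩

theorem IsWeaklyMixing.not_isOpen_singleton [T1Space X] [Nontrivial X]
    (hmix : IsWeaklyMixing f) (x : X) : ¬ IsOpen ({x} : Set X) := by
  intro hx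
  obtain ⟨y, hy⟩ := exists_ne x
  obtain ⟨k, -, ⟨a, rfl, ha⟩, ⟨b, rfl, hb⟩⟩ := hmix.exists_pair hx (singleton_nonempty x) hx
    (singleton_nonempty x) hx (singleton_nonempty x) (isOpen_compl_singleton (x := x)) ⟨y, hy⟩
  exact hb ha

/-- Transitivity gives dense range: an orbit entering an open set at a positive time does so from a
point of its preimage. -/
theorem IsWeaklyMixing.nonempty_preimage (hf : Continuous f) (hmix : IsWeaklyMixing f)
    (n : ℕ) {B : Set X} (hB : IsOpen B) (hB' : B.Nonempty) : (f^[n] ⁻¹' B).Nonempty := by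
  induction n with
  | zero => simpa using hB'
  | succ n ih =>
    have ho := hB.preimage (hf.iterate n)
    obtain ⟨k, hk, ⟨a, -, ha⟩, -⟩ := hmix.exists_pair ho ih ho ih ho ih ho ih
    obtain ⟨k, rfl⟩ := Nat.exists_eq_succ_of_ne_zero hk.ne'
    refine ⟨f^[k] a, ?_⟩
    rw [mem_preimage, mem_preimage] at ha
    rwa [mem_preimage, Function.iterate_succ_apply, ← Function.iterate_succ_apply' f k]

/-- The hitting time sets of finitely many pairs of open sets contain a common hitting time set. -/
theorem IsWeaklyMixing.exists_common [Nonempty X] (hf : Continuous f) (hmix : IsWeaklyMixing f)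
    {ι : Type*} (s : Finset ι) (U V : ι → Set X)
    (hU : ∀ i ∈ s, IsOpen (U i) ∧ (U i).Nonempty) (hV : ∀ i ∈ s, IsOpen (V i) ∧ (V i).Nonempty) :
    ∃ A B : Set X, IsOpen A ∧ A.Nonempty ∧ IsOpen B ∧ B.Nonempty ∧
      ∀ n, (A ∩ f^[n] ⁻¹' B).Nonempty → ∀ i ∈ s, (U i ∩ f^[n] ⁻¹' V i).Nonempty := by
  classical
  induction s using Finset.induction_on with
  | empty =>
    exact ⟨univ, univ, isOpen_univ, univ_nonempty, isOpen_univ, univ_nonempty, by simp⟩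
  | insert a s _ ih =>
    obtain ⟨A, B, hA, hA', hB, hB', h⟩ := ih (fun i hi => hU i (Finset.mem_insert_of_mem hi))
      (fun i hi => hV i (Finset.mem_insert_of_mem hi))
    obtain ⟨hUa, hUa'⟩ := hU a (Finset.mem_insert_self a s)
    obtain ⟨hVa, hVa'⟩ := hV a (Finset.mem_insert_self a s)
    obtain ⟨k, -, h₁, h₂⟩ := hmix.exists_pair hA hA' hUa hUa' hB hB' hVa hVa'
    -- If `x` goes from the new `A` to the new `B` in time `n`, so does `x` for the old pair, and
    -- `f^[k] x` goes from `U a` to `V a`, since iterates commute.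
    refine ⟨_, _, hA.inter (hUa.preimage (hf.iterate k)), h₁,
      hB.inter (hVa.preimage (hf.iterate k)), h₂, ?_⟩
    rintro n ⟨x, ⟨hxA, hxU⟩, hxB, hxV⟩ i hi
    rcases Finset.mem_insert.1 hi with rfl | hi
    · refine ⟨f^[k] x, hxU, ?_⟩
      rw [mem_preimage] at hxV ⊢
      rwa [← Function.iterate_add_apply, add_comm, Function.iterate_add_apply]
    · exact h n ⟨x, hxA, hxB⟩ i hi

/-- Applying `exists_common` again to the pairs `A`, `f^[i] ⁻¹' B` shows that the hitting times of
`A`, `B` contain long blocks of consecutive integers, hence large multiples of `d`. -/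
theorem IsWeaklyMixing.exists_dvd_time [Nonempty X] (hf : Continuous f) (hmix : IsWeaklyMixing f)
    {ι : Type*} (s : Finset ι) (U V : ι → Set X)
    (hU : ∀ i ∈ s, IsOpen (U i) ∧ (U i).Nonempty) (hV : ∀ i ∈ s, IsOpen (V i) ∧ (V i).Nonempty)
    (d N : ℕ) (hd : 0 < d) :
    ∃ m, N < m ∧ d ∣ m ∧ ∀ i ∈ s, (U i ∩ f^[m] ⁻¹' V i).Nonempty := by
  obtain ⟨A, B, hA, hA', hB, hB', h⟩ := hmix.exists_common hf s U V hU hV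
  obtain ⟨C, D, hC, hC', hD, hD', h'⟩ := hmix.exists_common hf
    (Finset.range ((N + 1) * d + 1)) (fun _ => A) (fun i => f^[i] ⁻¹' B) (fun _ _ => ⟨hA, hA'⟩)
    (fun i _ => ⟨hB.preimage (hf.iterate i), hmix.nonempty_preimage hf i hB hB'⟩)
  obtain ⟨n, -, hn, -⟩ := hmix.exists_pair hC hC' hD hD' hC hC' hD hD'
  have hmod : n % d < d := Nat.mod_lt n hd
  have hdN : d ≤ (N + 1) * d := Nat.le_mul_of_pos_left d (Nat.succ_pos N)
  -- This shift rounds `n` to a multiple of `d`; the summand `(N + 1) * d` makes it exceed `N` and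
  -- keeps the subtraction honest.
  obtain ⟨x, hxA, hxB⟩ := h' n hn ((N + 1) * d - n % d) (Finset.mem_range.2 (by omega))
  have hsum : (N + 1) * d - n % d + n = (n / d + (N + 1)) * d := by
    have := Nat.div_add_mod' n d
    rw [add_mul (n / d)]; omega
  rw [mem_preimage, mem_preimage, ← Function.iterate_add_apply, hsum] at hxB
  refine ⟨_, ?_, Dvd.intro_left _ rfl, h _ ⟨x, hxA, hxB⟩⟩
  calc N < n / d + (N + 1) := Nat.lt_add_left _ (Nat.lt_succ_self N)
    _ ≤ (n / d + (N + 1)) * d := Nat.le_mul_of_pos_right _ hd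

end WeakMixing

/-! ### Polishness and the Baire property -/

/-- A dense, locally compact image in a Hausdorff space is open. -/
theorem isOpen_range_of_isEmbedding_of_denseRange {X Y : Type*} [TopologicalSpace X] [TopologicalSpace Y]
    [LocallyCompactSpace X] [T2Space Y] {e : X → Y} (he : IsEmbedding e) (hd : DenseRange e) :
    IsOpen (range e) := by
  rw [isOpen_iff_mem_nhds]
  rintro _ ⟨x, rfl⟩
  obtain ⟨K, hK, hKx⟩ := exists_compact_mem_nhds x
  rw [he.isInducing.nhds_eq_comap, mem_comap] at hKx
  obtain ⟨t, ht, htK⟩ := hKx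
  obtain ⟨U, hUt, hU, hxU⟩ := mem_nhds_iff.1 ht
  refine mem_of_superset (hU.mem_nhds hxU) ?_
  have hcl : IsClosed (e '' K) := (hK.image he.continuous).isClosed
  calc U ⊆ closure (U ∩ range e) := hd.open_subset_closure_inter hU
    _ ⊆ e '' K := by
      refine closure_minimal ?_ hcl
      rintro _ ⟨hy, x', rfl⟩
      exact ⟨x', htK (hUt hy), rfl⟩
    _ ⊆ range e := image_subset_range e K

/-- The given metric need not be complete, but `X` is open in its completion, which is Polish. -/
theorem polishSpace_of_locallyCompact (X : Type*) [MetricSpace X] [LocallyCompactSpace X]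
    [TopologicalSpace.SeparableSpace X] : PolishSpace X := by
  have he : IsEmbedding ((↑) : X → UniformSpace.Completion X) :=
    (UniformSpace.Completion.isUniformEmbedding_coe X).isEmbedding
  have ho := isOpen_range_of_isEmbedding_of_denseRange he UniformSpace.Completion.denseRange_coe
  have : SecondCountableTopology (UniformSpace.Completion X) :=
    UniformSpace.secondCountable_of_separable _
  have : PolishSpace (UniformSpace.Completion X) := inferInstance
  have := ho.polishSpace
  exact he.toHomeomorph.isClosedEmbedding.polishSpace

theorem baireSpace_pi_continuousMap (X : Type*) [TopologicalSpace X] [PolishSpace X] :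
    BaireSpace (ℕ → C(ℕ → Bool, X)) := by
  -- The compact-open topology depends only on the topology of `X`, so a complete metric may be
  -- substituted.
  let := TopologicalSpace.upgradeIsCompletelyMetrizable X
  infer_instance

/-! ### The Cantor space: cylinders and finite words -/

theorem exists_cylinder_subset {t : ℕ → Bool} {V : Set (ℕ → Bool)} (hV : IsOpen V) (htV : t ∈ V) :
    ∃ n, PiNat.cylinder t n ⊆ V := by
  obtain ⟨_, ⟨y, n, rfl⟩, hty, hs⟩ :=
    (PiNat.isTopologicalBasis_cylinders (fun _ : ℕ => Bool)).exists_subset_of_mem_open htV hV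
  exact ⟨n, by rwa [PiNat.mem_cylinder_iff_eq.1 hty]⟩

theorem preperfect_univ_cantor : Preperfect (univ : Set (ℕ → Bool)) := by
  rw [preperfect_iff_nhds]
  intro t _ U hU
  obtain ⟨V, hVU, hV, htV⟩ := mem_nhds_iff.1 hU
  obtain ⟨n, hn⟩ := exists_cylinder_subset hV htV
  refine ⟨Function.update t n (!t n), ⟨hVU (hn (PiNat.update_mem_cylinder t n _)), mem_univ _⟩, ?_⟩
  intro h
  simpa using congrFun h n

theorem isCantorSet_range {X : Type*} [TopologicalSpace X] [T2Space X] {g : (ℕ → Bool) → X}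
    (hg : Continuous g) (hinj : Function.Injective g) : IsCantorSet (range g) := by
  have he : IsClosedEmbedding g := hg.isClosedEmbedding hinj
  refine ⟨range_nonempty g, isCompact_range hg, ⟨he.isClosed_range, ?_⟩,
    he.isEmbedding.isTotallyDisconnected_range.2 inferInstance⟩
  rw [preperfect_iff_nhds]
  rintro _ ⟨t, rfl⟩ U hU
  obtain ⟨s, ⟨hs, -⟩, hst⟩ := preperfect_iff_nhds.1 preperfect_univ_cantor t (mem_univ t) _
    (hg.continuousAt.preimage_mem_nhds hU)
  exact ⟨g s, ⟨hs, mem_range_self s⟩, hinj.ne hst⟩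

/-- The first `n` digits of a point of the Cantor space. -/
def digits (n : ℕ) (t : ℕ → Bool) : Fin n → Bool := fun i => t i

/-- The point of the Cantor space with given first digits, followed by `false`. -/
def padWord {n : ℕ} (s : Fin n → Bool) : ℕ → Bool := fun i => if h : i < n then s ⟨i, h⟩ else false

theorem continuous_digits (n : ℕ) : Continuous (digits n) :=
  continuous_pi fun i => continuous_apply (i : ℕ)

theorem digits_padWord {n : ℕ} (s : Fin n → Bool) : digits n (padWord s) = s := by
  funext i; simp [digits, padWord]

theorem mem_cylinder_iff_digits_eq {n : ℕ} {t t' : ℕ → Bool} :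
    t' ∈ PiNat.cylinder t n ↔ digits n t' = digits n t := by
  rw [PiNat.mem_cylinder_iff, funext_iff]
  exact ⟨fun h i => h i i.2, fun h i hi => h ⟨i, hi⟩⟩

theorem digits_eq_of_le {m n : ℕ} (h : m ≤ n) {t t' : ℕ → Bool} (ht : digits n t = digits n t') :
    digits m t = digits m t' :=
  mem_cylinder_iff_digits_eq.1 (PiNat.cylinder_anti _ h (mem_cylinder_iff_digits_eq.2 ht))

/-! ### Generic sequences of maps of the Cantor space -/

section Box

variable {X : Type*} [MetricSpace X]

theorem exists_digits_dist_lt (g : C(ℕ → Bool, X)) {ε : ℝ} (hε : 0 < ε) :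
    ∃ n, ∀ t t', digits n t = digits n t' → dist (g t) (g t') < ε := by
  suffices h : ∃ n, ∀ t ∈ (univ : Set (ℕ → Bool)), ∀ t', digits n t = digits n t' →
      dist (g t) (g t') < ε from h.imp fun n hn t t' => hn t (mem_univ t) t'
  -- Only `t` is confined to `s`, while `t'` is free; this makes the property stable under unions.
  refine isCompact_univ.induction_on
    (p := fun s => ∃ n, ∀ t ∈ s, ∀ t', digits n t = digits n t' → dist (g t) (g t') < ε) ?_ ?_ ?_ ?_
  · exact ⟨0, by simp⟩
  · rintro s s' hs ⟨n, hn⟩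
    exact ⟨n, fun t ht => hn t (hs ht)⟩
  · rintro s s' ⟨n, hn⟩ ⟨n', hn'⟩
    refine ⟨max n n', fun t ht t' h => ?_⟩
    rcases ht with ht | ht
    · exact hn t ht t' (digits_eq_of_le (le_max_left _ _) h)
    · exact hn' t ht t' (digits_eq_of_le (le_max_right _ _) h)
  · intro t _
    obtain ⟨n, hn⟩ := exists_cylinder_subset (t := t)
      (Metric.isOpen_ball.preimage g.continuous : IsOpen (g ⁻¹' Metric.ball (g t) (ε / 2)))
      (by simpa using hε)
    refine ⟨PiNat.cylinder t n, mem_nhdsWithin_of_mem_nhds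
      ((PiNat.isOpen_cylinder _ t n).mem_nhds (PiNat.self_mem_cylinder t n)), n, ?_⟩
    intro t₁ h₁ t₂ h
    have h₂ : t₂ ∈ PiNat.cylinder t n :=
      mem_cylinder_iff_digits_eq.2 (h.symm.trans (mem_cylinder_iff_digits_eq.1 h₁))
    have e₁ : dist (g t₁) (g t) < ε / 2 := hn h₁
    have e₂ : dist (g t₂) (g t) < ε / 2 := hn h₂
    calc dist (g t₁) (g t₂) ≤ dist (g t₁) (g t) + dist (g t₂) (g t) := dist_triangle_right _ _ _
      _ < ε := by linarith

/-- A neighbourhood of a sequence of maps contains every sequence which, on finitely many levels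
and up to finitely many digits, takes values in suitable nonempty open sets. -/
theorem exists_box {W : Set (ℕ → C(ℕ → Bool, X))} (hW : IsOpen W) {φ : ℕ → C(ℕ → Bool, X)}
    (hφ : φ ∈ W) (L₀ n₀ : ℕ) :
    ∃ L n, L₀ ≤ L ∧ n₀ ≤ n ∧ ∃ U : ℕ → (Fin n → Bool) → Set X,
      (∀ j s, IsOpen (U j s) ∧ (U j s).Nonempty) ∧
      ∀ ψ : ℕ → C(ℕ → Bool, X), (∀ j < L, ∀ t, ψ j t ∈ U j (digits n t)) → ψ ∈ W := by
  obtain ⟨I, u, hu, hI⟩ := isOpen_pi_iff.1 hW φ hφ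
  -- The box has radius `ε` about the value at `padWord s`, and the oscillation on a cylinder adds
  -- less than `ε`, hence `2 * ε`.
  have key : ∀ j, ∃ ε > 0, ∃ n, (∀ t t', digits n t = digits n t' → dist (φ j t) (φ j t') < ε) ∧
      (j ∈ I → Metric.ball (φ j) (2 * ε) ⊆ u j) := by
    intro j
    by_cases hj : j ∈ I
    · obtain ⟨ε, hε, h⟩ := Metric.isOpen_iff.1 (hu j hj).1 _ (hu j hj).2
      obtain ⟨n, hn⟩ := exists_digits_dist_lt (φ j) (half_pos hε)
      exact ⟨ε / 2, half_pos hε, n, hn, fun _ => by rwa [mul_div_cancel₀ _ two_ne_zero]⟩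
    · obtain ⟨n, hn⟩ := exists_digits_dist_lt (φ j) one_pos
      exact ⟨1, one_pos, n, hn, fun h => absurd h hj⟩
  choose ε hε n hn hball using key
  have hle : ∀ j ∈ I, n j ≤ n₀ + ∑ i ∈ I, n i := fun j hj =>
    (Finset.single_le_sum (fun i _ => Nat.zero_le (n i)) hj).trans (Nat.le_add_left _ _)
  refine ⟨L₀ + (I.sup id + 1), n₀ + ∑ i ∈ I, n i, Nat.le_add_right _ _, Nat.le_add_right _ _,
    fun j s => Metric.ball (φ j (padWord s)) (ε j),
    fun j s => ⟨Metric.isOpen_ball, ⟨_, Metric.mem_ball_self (hε j)⟩⟩, ?_⟩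
  intro ψ hψ
  refine hI fun j hj => hball j hj ?_
  have hjL : j < L₀ + (I.sup id + 1) :=
    Nat.lt_add_left _ (Nat.lt_succ_of_le (Finset.le_sup (f := id) hj))
  rw [Metric.mem_ball, ContinuousMap.dist_lt_iff (by linarith [hε j])]
  intro t
  have h₁ := Metric.mem_ball.1 (hψ j hjL t)
  have h₂ := hn j (padWord (digits _ t)) t (digits_eq_of_le (hle j hj) (digits_padWord _))
  calc dist (ψ j t) (φ j t) ≤ _ := dist_triangle _ _ _
    _ < 2 * ε j := by linarith

/-- Finitely many conditions on compact cylinders, each open in the compact-open topology. -/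
theorem isOpen_setOf_forall_mem_digits {n : ℕ} {G : (Fin n → Bool) → Set X}
    (hG : ∀ s, IsOpen (G s)) : IsOpen {g : C(ℕ → Bool, X) | ∀ t, g t ∈ G (digits n t)} := by
  have h : {g : C(ℕ → Bool, X) | ∀ t, g t ∈ G (digits n t)} =
      ⋂ s : Fin n → Bool, {g : C(ℕ → Bool, X) | MapsTo g (digits n ⁻¹' {s}) (G s)} := by
    ext g
    simp only [mem_ofPred_eq, mem_iInter]
    exact ⟨fun h s t ht => by rw [← show digits n t = s from ht]; exact h t, fun h t => h _ rfl⟩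
  rw [h]
  exact isOpen_iInter_of_finite fun s => ContinuousMap.isOpen_setOfPred_mapsTo
    ((isClosed_singleton.preimage (continuous_digits n)).isCompact) (hG s)

/-- Sequences of maps whose first members are carried, at a common time divisible by `N!`, to
prescribed open sets, which may depend on the time but are taken from a finite collection. -/
theorem eventually_residual_exists_time [Nonempty X] {f : X → X} (hf : Continuous f)
    (hmix : IsWeaklyMixing f) {𝒲 : Set (Set X)} (h𝒲 : 𝒲.Finite)
    (h𝒲' : ∀ W ∈ 𝒲, IsOpen W ∧ W.Nonempty) (L n N : ℕ) (V : ℕ → ℕ → (Fin n → Bool) → Set X)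
    (hV : ∀ m j s, V m j s ∈ 𝒲) :
    ∀ᶠ φ : ℕ → C(ℕ → Bool, X) in residual _,
      ∃ m, N < m ∧ N.factorial ∣ m ∧ ∀ j < L, ∀ t, f^[m] (φ j t) ∈ V m j (digits n t) := by
  refine residual_of_dense_open ?_ ?_
  · have : {φ : ℕ → C(ℕ → Bool, X) | ∃ m, N < m ∧ N.factorial ∣ m ∧
        ∀ j < L, ∀ t, f^[m] (φ j t) ∈ V m j (digits n t)} =
        ⋃ (m : ℕ) (_ : N < m) (_ : N.factorial ∣ m), ⋂ j ∈ Iio L, (fun φ => φ j) ⁻¹'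
          {g : C(ℕ → Bool, X) | ∀ t, g t ∈ f^[m] ⁻¹' V m j (digits n t)} := by
      ext φ; simp [and_left_comm]
    rw [this]
    refine isOpen_iUnion fun m => isOpen_iUnion fun _ => isOpen_iUnion fun _ =>
      (finite_Iio L).isOpen_biInter fun j _ => ?_
    exact (isOpen_setOf_forall_mem_digits (G := fun s => f^[m] ⁻¹' V m j s) fun s =>
      (h𝒲' _ (hV m j s)).1.preimage (hf.iterate m)).preimage (continuous_apply j)
  · rw [dense_iff_inter_open]
    rintro O hO ⟨φ, hφ⟩
    obtain ⟨L', n', hL, hn, U, hU, hUO⟩ := exists_box hO hφ L n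
    -- The targets depend on `m`, which is not yet known. As `𝒲` is finite, `m` can be chosen to
    -- work for every box and every member of `𝒲` at once.
    obtain ⟨m, hNm, hdvd, hm⟩ := hmix.exists_dvd_time hf
      ((Finset.univ : Finset (Fin L' × (Fin n' → Bool))) ×ˢ h𝒲.toFinset)
      (fun i => U i.1.1 i.1.2) (fun i => i.2) (fun i _ => hU _ _)
      (fun i hi => h𝒲' _ (h𝒲.mem_toFinset.1 (Finset.mem_product.1 hi).2)) N.factorial N
      N.factorial_pos
    have key : ∀ j s, ∃ y, y ∈ U j s ∧ (j < L' → f^[m] y ∈ V m j (digits n (padWord s))) := by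
      intro j s
      by_cases hj : j < L'
      · obtain ⟨y, hyU, hyV⟩ := hm ((⟨j, hj⟩, s), V m j (digits n (padWord s)))
          (by simpa using hV _ _ _)
        exact ⟨y, hyU, fun _ => hyV⟩
      · obtain ⟨y, hy⟩ := (hU j s).2
        exact ⟨y, hy, fun h => absurd h hj⟩
    choose y hyU hyV using key
    -- The witness is constant on the cylinders of length `n'`.
    refine ⟨fun j => ⟨fun t => y j (digits n' t),
      (continuous_of_discreteTopology (f := y j)).comp (continuous_digits n')⟩,
      hUO _ fun j _ t => hyU j _, m, hNm, hdvd, fun j hj t => ?_⟩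
    have h := hyV j (digits n' t) (hj.trans_le hL)
    rwa [digits_eq_of_le hn (digits_padWord (digits n' t))] at h

/-- A basic neighbourhood restricts finitely many coordinates, so a later one can be replaced by a
constant map into `O`. -/
theorem eventually_residual_exists_range_subset {O : Set X} (hO : IsOpen O) (hO' : O.Nonempty)
    (N : ℕ) : ∀ᶠ φ : ℕ → C(ℕ → Bool, X) in residual _, ∃ j, N < j ∧ range (φ j) ⊆ O := by
  refine residual_of_dense_open ?_ ?_
  · have : {φ : ℕ → C(ℕ → Bool, X) | ∃ j, N < j ∧ range (φ j) ⊆ O} =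
        ⋃ (j : ℕ) (_ : N < j), (fun φ => φ j) ⁻¹' {g : C(ℕ → Bool, X) | MapsTo g univ O} := by
      ext φ; simp [range_subset_iff, MapsTo]
    rw [this]
    exact isOpen_iUnion fun j => isOpen_iUnion fun _ =>
      (ContinuousMap.isOpen_setOfPred_mapsTo isCompact_univ hO).preimage (continuous_apply j)
  · rw [dense_iff_inter_open]
    rintro W hW ⟨φ, hφ⟩
    obtain ⟨x, hx⟩ := hO'
    obtain ⟨I, u, hu, hI⟩ := isOpen_pi_iff.1 hW φ hφ
    have hlt : ∀ j ∈ I, j < N + (I.sup id + 1) := fun j hj =>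
      Nat.lt_add_left _ (Nat.lt_succ_of_le (Finset.le_sup (f := id) hj))
    refine ⟨Function.update φ (N + (I.sup id + 1)) (ContinuousMap.const _ x), hI fun j hj => ?_,
      N + (I.sup id + 1), by omega, ?_⟩
    · rw [Function.update_of_ne (hlt j hj).ne]
      exact (hu j hj).2
    · rw [Function.update_self]
      rintro _ ⟨t, rfl⟩
      exact hx

end Box

/-! ### Generic families and their sets of times -/

section GenericFamily

variable {X : Type*} [MetricSpace X]

/-- A sequence of maps of the Cantor space, together with a set `M` of times, such that at infinitely
many times in `M` any prescribed itinerary is realized on finitely many levels. -/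
structure IsGenericFamily (f : X → X) (φ : ℕ → C(ℕ → Bool, X)) (M : Set ℕ) : Prop where
  infinite : M.Infinite
  pos : ∀ m ∈ M, 0 < m
  factorial_dvd : ∀ n : ℕ, 1 ≤ n → ∃ N : ℕ, ∀ m ∈ M, N ≤ m → n.factorial ∣ m
  frequently : ∀ (L n : ℕ) (V : ℕ → (Fin n → Bool) → Set X),
    (∀ j s, IsOpen (V j s) ∧ (V j s).Nonempty) →
    ∃ᶠ m in atTop ⊓ 𝓟 M, ∀ j < L, ∀ t, f^[m] (φ j t) ∈ V j (digits n t)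

theorem frequently_atTop_inf_principal {M : Set ℕ} {p : ℕ → Prop} :
    (∃ᶠ m in atTop ⊓ 𝓟 M, p m) ↔ ∀ N, ∃ m, N ≤ m ∧ m ∈ M ∧ p m := by
  rw [frequently_inf_principal, frequently_atTop]

theorem eventually_residual_forall_itinerary [SecondCountableTopology X] [Nonempty X] {f : X → X}
    (hf : Continuous f) (hmix : IsWeaklyMixing f) :
    ∀ᶠ φ : ℕ → C(ℕ → Bool, X) in residual _,
      ∀ (τ : (Σ L n : ℕ, Fin L × (Fin n → Bool) → TopologicalSpace.countableBasis X)) (N : ℕ),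
        ∃ m, N < m ∧ N.factorial ∣ m ∧
          ∀ (j : Fin τ.1) (t : ℕ → Bool),
            f^[m] (φ j t) ∈ (τ.2.2 (j, digits τ.2.1 t) : Set X) := by
  refine eventually_countable_forall.2 fun ⟨L, n, F⟩ => eventually_countable_forall.2 fun N => ?_
  refine (eventually_residual_exists_time hf hmix
    (𝒲 := insert univ (range fun i => (F i : Set X))) ((finite_range _).insert _) ?_ L n N
    -- `univ` fills the levels from `L` on, which are never tested.
    (fun _ j s => if h : j < L then (F (⟨j, h⟩, s) : Set X) else univ) ?_).mono ?_
  · rintro W (rfl | ⟨i, rfl⟩)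
    · exact ⟨isOpen_univ, univ_nonempty⟩
    · exact ⟨TopologicalSpace.isOpen_of_mem_countableBasis (F i).2,
        TopologicalSpace.nonempty_of_mem_countableBasis (F i).2⟩
  · intro m j s
    by_cases h : j < L
    · simp [h]
    · simp [h]
  · rintro φ ⟨m, hm, hdvd, h⟩
    refine ⟨m, hm, hdvd, fun j t => ?_⟩
    simpa using h j j.2 t

/-- The `k`-th time exceeds `k`, is divisible by `k!`, and serves the itinerary numbered
`k.unpair.1`; thus every itinerary is served infinitely often. -/
theorem exists_isGenericFamily [SecondCountableTopology X] [Nonempty X] {f : X → X}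
    {φ : ℕ → C(ℕ → Bool, X)}
    (h : ∀ (τ : (Σ L n : ℕ, Fin L × (Fin n → Bool) → TopologicalSpace.countableBasis X)) (N : ℕ),
        ∃ m, N < m ∧ N.factorial ∣ m ∧
          ∀ (j : Fin τ.1) (t : ℕ → Bool),
            f^[m] (φ j t) ∈ (τ.2.2 (j, digits τ.2.1 t) : Set X)) :
    ∃ M, IsGenericFamily f φ M := by
  choose m hlt hdvd hm using h
  have : Nonempty (Σ L n : ℕ, Fin L × (Fin n → Bool) → TopologicalSpace.countableBasis X) :=
    ⟨⟨0, 0, fun i => i.1.elim0⟩⟩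
  obtain ⟨e, he⟩ := exists_surjective_nat
    (Σ L n : ℕ, Fin L × (Fin n → Bool) → TopologicalSpace.countableBasis X)
  have hunb : ∀ N, ∃ k ∈ range fun k => m (e k.unpair.1) k, N < k :=
    fun N => ⟨_, ⟨N, rfl⟩, hlt _ N⟩
  refine ⟨range fun k => m (e k.unpair.1) k, ⟨?_, ?_, ?_, ?_⟩⟩
  · exact infinite_of_forall_exists_gt hunb
  · rintro _ ⟨k, rfl⟩
    exact (Nat.zero_le k).trans_lt (hlt _ k)
  · intro n _
    -- This sum exceeds each time of index `k < n`, so a member of `M` beyond it has index at least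
    -- `n`.
    refine ⟨∑ k ∈ Finset.range n, (m (e k.unpair.1) k + 1), ?_⟩
    rintro _ ⟨k, rfl⟩ hk
    refine (Nat.factorial_dvd_factorial ?_).trans (hdvd _ k)
    by_contra! hkn
    have := Finset.single_le_sum (f := fun k => m (e k.unpair.1) k + 1)
      (fun i _ => Nat.zero_le _) (Finset.mem_range.2 hkn)
    exact absurd (this.trans hk) (by simp)
  · intro L n V hV
    rw [frequently_atTop_inf_principal]
    intro N
    have hb : ∀ j s, ∃ B : TopologicalSpace.countableBasis X, (B : Set X) ⊆ V j s := by
      intro j s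
      obtain ⟨x, hx⟩ := (hV j s).2
      obtain ⟨B, hB, -, hBV⟩ := (TopologicalSpace.isBasis_countableBasis X).exists_subset_of_mem_open
        hx (hV j s).1
      exact ⟨⟨B, hB⟩, hBV⟩
    choose B hB using hb
    obtain ⟨a, ha⟩ := he ⟨L, n, fun i => B i.1 i.2⟩
    exact ⟨_, (Nat.right_le_pair a N).trans (hlt ⟨L, n, fun i => B i.1 i.2⟩ _).le,
      ⟨Nat.pair a N, by simp only [Nat.unpair_pair, ha]⟩,
      fun j hj t => hB _ _ (hm ⟨L, n, fun i => B i.1 i.2⟩ _ ⟨j, hj⟩ t)⟩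

/-- The existence of a generic family, which also hits at infinitely many times the values of
countably many prescribed selectors. -/
theorem exists_isGenericFamily_forall_selector [Nonempty X] [LocallyCompactSpace X]
    [TopologicalSpace.SeparableSpace X] {f : X → X} (hf : Continuous f) (hmix : IsWeaklyMixing f)
    {ι : Type*} [Countable ι] (σ : ι → ℕ → Set X) (hfin : ∀ i, (range (σ i)).Finite)
    (hσ : ∀ i m, IsOpen (σ i m) ∧ (σ i m).Nonempty) :
    ∃ φ M, IsGenericFamily f φ M ∧
      (∀ O : Set X, IsOpen O → O.Nonempty → {j | range (φ j) ⊆ O}.Infinite) ∧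
      ∀ i L N, ∃ m, N < m ∧ ∀ j < L, ∀ t, f^[m] (φ j t) ∈ σ i m := by
  have := UniformSpace.secondCountable_of_separable X
  have := polishSpace_of_locallyCompact X
  have := baireSpace_pi_continuousMap X
  have h₁ := eventually_residual_forall_itinerary hf hmix
  have h₂ : ∀ᶠ φ : ℕ → C(ℕ → Bool, X) in residual _,
      ∀ (O : TopologicalSpace.countableBasis X) (N : ℕ), ∃ j, N < j ∧ range (φ j) ⊆ O :=
    eventually_countable_forall.2 fun O => eventually_countable_forall.2 fun N =>
      eventually_residual_exists_range_subset
        (TopologicalSpace.isOpen_of_mem_countableBasis O.2)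
        (TopologicalSpace.nonempty_of_mem_countableBasis O.2) N
  have h₃ : ∀ᶠ φ : ℕ → C(ℕ → Bool, X) in residual _,
      ∀ i L N, ∃ m, N < m ∧ N.factorial ∣ m ∧ ∀ j < L, ∀ t, f^[m] (φ j t) ∈ σ i m :=
    eventually_countable_forall.2 fun i => eventually_countable_forall.2 fun L =>
      eventually_countable_forall.2 fun N =>
        eventually_residual_exists_time hf hmix (hfin i) (forall_mem_range.2 (hσ i)) L 0 N
          (fun m _ _ => σ i m) (fun m _ _ => mem_range_self m)
  have : Nonempty (ℕ → C(ℕ → Bool, X)) :=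
    ⟨fun _ => ContinuousMap.const _ (Classical.arbitrary X)⟩
  obtain ⟨φ, ⟨hφ₁, hφ₂⟩, hφ₃⟩ := (dense_of_mem_residual (h₁.and h₂ |>.and h₃)).nonempty
  obtain ⟨M, hM⟩ := exists_isGenericFamily hφ₁
  refine ⟨φ, M, hM, fun O hO ⟨x, hx⟩ => ?_, fun i L N => ?_⟩
  · obtain ⟨B, hB, -, hBO⟩ :=
      (TopologicalSpace.isBasis_countableBasis X).exists_subset_of_mem_open hx hO
    refine infinite_of_forall_exists_gt fun N => ?_
    obtain ⟨j, hj, h⟩ := hφ₂ ⟨B, hB⟩ N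
    exact ⟨j, h.trans hBO, hj⟩
  · obtain ⟨m, hm, -, h⟩ := hφ₃ i L N
    exact ⟨m, hm, h⟩

end GenericFamily

/-! ### Limits of distances, and selectors near or far from a point -/

theorem liminf_eq_zero_of_frequently_lt {α : Type*} {F : Filter α} {u : α → ℝ≥0∞}
    (h : ∀ ε > 0, ∃ᶠ a in F, u a < ε) : liminf u F = 0 := by
  by_contra hne
  obtain ⟨ε, hε, hε'⟩ := exists_between (pos_iff_ne_zero.2 hne)
  obtain ⟨a, ha, ha'⟩ := ((h ε hε).and_eventually (eventually_lt_of_lt_liminf hε')).exists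
  exact lt_asymm ha ha'

theorem le_limsup_of_forall_frequently_le {α : Type*} {F : Filter α} {u : α → ℝ≥0∞} {β : ℝ≥0∞}
    (h : ∀ b < β, ∃ᶠ a in F, b ≤ u a) : β ≤ limsup u F :=
  le_of_forall_lt_imp_le_of_dense fun b hb => le_limsup_of_frequently_le (h b hb)

section Metric

variable {X : Type*} [MetricSpace X]

theorem edist_le_spaceDiam (x y : X) : edist x y ≤ spaceDiam X :=
  le_iSup₂ (f := fun x y : X => edist x y) x y

theorem spaceDiam_pos [Nontrivial X] : 0 < spaceDiam X := by
  obtain ⟨x, y, hxy⟩ := exists_pair_ne X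
  exact (edist_pos.2 hxy).trans_le (edist_le_spaceDiam x y)

theorem exists_isOpen_pair_lt_edist {b : ℝ≥0∞} (hb : b < spaceDiam X) :
    ∃ A B : Set X, IsOpen A ∧ A.Nonempty ∧ IsOpen B ∧ B.Nonempty ∧
      ∀ u ∈ A, ∀ w ∈ B, b < edist u w := by
  obtain ⟨x, hx⟩ := lt_iSup_iff.1 hb
  obtain ⟨y, hy⟩ := lt_iSup_iff.1 hx
  have ho : IsOpen {p : X × X | b < edist p.1 p.2} := isOpen_lt continuous_const continuous_edist
  obtain ⟨A, B, hA, hB, hxA, hyB, h⟩ := isOpen_prod_iff.1 ho x y hy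
  exact ⟨A, B, hA, ⟨x, hxA⟩, hB, ⟨y, hyB⟩, fun u hu w hw => h (mk_mem_prod hu hw)⟩

theorem rigidityConst_le_spaceDiam (f : X → X) : rigidityConst f ≤ spaceDiam X :=
  (iInf₂_le 1 le_rfl).trans (iSup_le fun _ => edist_le_spaceDiam _ _)

theorem ediam_le_two_mul {D : Set X} {v : X} {ε : ℝ≥0∞} (h : ∀ y ∈ D, edist y v ≤ ε) :
    Metric.ediam D ≤ 2 * ε :=
  Metric.ediam_le fun x hx y hy => (edist_triangle_right x y v).trans <| by
    rw [two_mul]; exact add_le_add (h x hx) (h y hy)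

theorem exists_strictMono_tendsto_ediam {p : ℕ → Prop} {D : ℕ → Set X}
    (h : ∀ ε > 0, ∃ᶠ m in atTop, p m ∧ Metric.ediam (D m) ≤ 2 * ε) :
    ∃ k : ℕ → ℕ, StrictMono k ∧ (∀ i, p (k i)) ∧
      Tendsto (fun i => Metric.ediam (D (k i))) atTop (𝓝 0) := by
  obtain ⟨k, hk, hpk⟩ := extraction_forall_of_frequently
    -- For `i = 0` the tolerance is `∞`, which is harmless.
    fun i : ℕ => h ((i : ℝ≥0∞)⁻¹) (ENNReal.inv_pos.2 (ENNReal.natCast_ne_top i))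
  refine ⟨k, hk, fun i => (hpk i).1, tendsto_of_tendsto_of_tendsto_of_le_of_le tendsto_const_nhds
    ?_ (fun _ => zero_le) fun i => (hpk i).2⟩
  simpa using ENNReal.Tendsto.const_mul ENNReal.tendsto_inv_nat_nhds_zero
    (Or.inr (ENNReal.ofNat_ne_top (n := 2)))

/-- A finite subcover of `K` by balls of radius `ε / 2` leaves finitely many targets, as the
category argument requires; off `K` the choice is `univ`. -/
theorem exists_near_selector [Nonempty X] {K : Set X} (hK : IsCompact K) {ε : ℝ≥0∞}
    (hε : 0 < ε) :
    ∃ S : X → Set X, (range S).Finite ∧ (∀ y, IsOpen (S y) ∧ (S y).Nonempty) ∧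
      ∀ y ∈ K, ∀ w ∈ S y, edist y w < ε := by
  have hε' : 0 < ε / 2 := ENNReal.half_pos hε.ne'
  obtain ⟨t, -, ht⟩ := hK.elim_nhds_subcover (fun x => Metric.eball x (ε / 2))
    fun x _ => Metric.eball_mem_nhds x hε'
  have key : ∀ y, ∃ W ∈ insert univ ((fun x => Metric.eball x (ε / 2)) '' (t : Set X)),
      y ∈ K → ∀ w ∈ W, edist y w < ε := by
    intro y
    by_cases hy : y ∈ K
    · obtain ⟨x, hx, hyx⟩ := mem_iUnion₂.1 (ht hy)
      refine ⟨_, mem_insert_of_mem _ ⟨x, hx, rfl⟩, fun _ w hw => ?_⟩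
      calc edist y w ≤ edist y x + edist w x := edist_triangle_right _ _ _
        _ < ε / 2 + ε / 2 := ENNReal.add_lt_add hyx hw
        _ = ε := ENNReal.add_halves ε
    · exact ⟨univ, mem_insert _ _, fun h => absurd h hy⟩
  choose S hS hSε using key
  refine ⟨S, ((t.finite_toSet.image _).insert _).subset (range_subset_iff.2 hS), fun y => ?_, hSε⟩
  rcases hS y with h | ⟨x, -, h⟩
  · rw [h]; exact ⟨isOpen_univ, univ_nonempty⟩
  · rw [← h]; exact ⟨Metric.isOpen_eball, ⟨x, Metric.mem_eball_self hε'⟩⟩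

open Classical in
/-- Whichever of two sets is farther from the given point. -/
noncomputable def fartherSet (A B : Set X) (y : X) : Set X :=
  if Metric.infEDist y B ≤ Metric.infEDist y A then A else B

theorem fartherSet_mem (A B : Set X) (y : X) : fartherSet A B y ∈ ({A, B} : Set (Set X)) := by
  unfold fartherSet; split_ifs <;> simp

/-- If the farther set had a point within `b` of `y`, both sets would, and the triangle inequality
would put them within `2 * b`. This is the source of `β / 2`. -/
theorem le_edist_of_mem_fartherSet {A B : Set X} {b : ℝ≥0∞}
    (h : ∀ u ∈ A, ∀ w ∈ B, b * 2 < edist u w) {y w : X} (hw : w ∈ fartherSet A B y) :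
    b ≤ edist y w := by
  by_contra! hlt
  have hAB : Metric.infEDist y A < b ∧ Metric.infEDist y B < b := by
    unfold fartherSet at hw
    split_ifs at hw with hle
    · have := (Metric.infEDist_le_edist_of_mem hw).trans_lt hlt
      exact ⟨this, hle.trans_lt this⟩
    · have := (Metric.infEDist_le_edist_of_mem hw).trans_lt hlt
      exact ⟨(not_le.1 hle).trans this, this⟩
  obtain ⟨u, hu, hyu⟩ := Metric.infEDist_lt_iff.1 hAB.1
  obtain ⟨v, hv, hyv⟩ := Metric.infEDist_lt_iff.1 hAB.2
  refine (h u hu v hv).not_ge ((edist_triangle_left u v y).trans ?_)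
  rw [mul_two]
  exact add_le_add hyu.le hyv.le

/-- A countable family of selectors, which choose open sets close to the given point (if it lies
in `K`) or far from it. -/
theorem exists_selectors [Nonempty X] [SecondCountableTopology X] {K : Set X} (hK : IsCompact K) :
    ∃ S : (ℕ ⊕ (TopologicalSpace.countableBasis X × TopologicalSpace.countableBasis X)) →
        X → Set X,
      (∀ i, (range (S i)).Finite) ∧ (∀ i y, IsOpen (S i y) ∧ (S i y).Nonempty) ∧
      (∀ ε > 0, ∃ i, ∀ y ∈ K, ∀ w ∈ S i y, edist y w < ε) ∧
      ∀ b < spaceDiam X / 2, ∃ i, ∀ y, ∀ w ∈ S i y, b ≤ edist y w := by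
  choose S hfin hopen hS using fun n : ℕ =>
    exists_near_selector hK (ENNReal.inv_pos.2 (ENNReal.natCast_ne_top n))
  refine ⟨Sum.elim S fun B => fartherSet (B.1 : Set X) B.2, ?_, ?_, ?_, ?_⟩
  · rintro (n | B)
    · exact hfin n
    · exact (toFinite {(B.1 : Set X), (B.2 : Set X)}).subset
        (range_subset_iff.2 (fartherSet_mem _ _))
  · rintro (n | B) y
    · exact hopen n y
    · have : ∀ C : TopologicalSpace.countableBasis X, IsOpen (C : Set X) ∧ (C : Set X).Nonempty :=
        fun C => ⟨TopologicalSpace.isOpen_of_mem_countableBasis C.2,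
          TopologicalSpace.nonempty_of_mem_countableBasis C.2⟩
      rcases fartherSet_mem (B.1 : Set X) B.2 y with h | h
      · rw [Sum.elim_inr, h]; exact this B.1
      · rw [Sum.elim_inr, mem_singleton_iff.1 h]; exact this B.2
  · intro ε hε
    obtain ⟨n, hn⟩ := ENNReal.exists_inv_nat_lt hε.ne'
    exact ⟨Sum.inl n, fun y hy w hw => (hS n y hy w hw).trans hn⟩
  · intro b hb
    obtain ⟨A, B, hA, ⟨x, hx⟩, hB, ⟨y, hy⟩, h⟩ :=
      exists_isOpen_pair_lt_edist (ENNReal.mul_lt_of_lt_div hb)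
    obtain ⟨A', hA', -, hAA⟩ :=
      (TopologicalSpace.isBasis_countableBasis X).exists_subset_of_mem_open hx hA
    obtain ⟨B', hB', -, hBB⟩ :=
      (TopologicalSpace.isBasis_countableBasis X).exists_subset_of_mem_open hy hB
    exact ⟨Sum.inr (⟨A', hA'⟩, ⟨B', hB'⟩), fun z w hw =>
      le_edist_of_mem_fartherSet (fun u hu v hv => h u (hAA hu) v (hBB hv)) hw⟩

/-! ### Dynamics of a generic family -/

namespace IsGenericFamily

variable {f : X → X} {φ : ℕ → C(ℕ → Bool, X)} {M : Set ℕ}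

theorem frequently_forall_mem (h : IsGenericFamily f φ M) (L : ℕ) {A : Set X} (hA : IsOpen A)
    (hA' : A.Nonempty) : ∃ᶠ m in atTop ⊓ 𝓟 M, ∀ j < L, ∀ t, f^[m] (φ j t) ∈ A :=
  h.frequently L 0 (fun _ _ => A) fun _ _ => ⟨hA, hA'⟩

theorem frequently_forall_edist_lt (h : IsGenericFamily f φ M) (L : ℕ) (v : X) {ε : ℝ≥0∞}
    (hε : 0 < ε) : ∃ᶠ m in atTop ⊓ 𝓟 M, ∀ j < L, ∀ t, edist (f^[m] (φ j t)) v < ε :=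
  h.frequently_forall_mem L Metric.isOpen_eball ⟨v, Metric.mem_eball_self hε⟩

/-- Different indices differ in level or in finitely many digits, so a single itinerary can send
them to unrelated targets. -/
theorem frequently_pair (h : IsGenericFamily f φ M) {c d : ℕ × (ℕ → Bool)} (hcd : c ≠ d)
    {A B : Set X} (hA : IsOpen A) (hA' : A.Nonempty) (hB : IsOpen B) (hB' : B.Nonempty) :
    ∃ᶠ m in atTop ⊓ 𝓟 M, f^[m] (φ c.1 c.2) ∈ A ∧ f^[m] (φ d.1 d.2) ∈ B := by
  classical
  obtain ⟨n, hn⟩ : ∃ n, ¬ (d.1 = c.1 ∧ digits n d.2 = digits n c.2) := by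
    by_contra! hall
    refine hcd (Prod.ext (hall 0).1.symm (funext fun i => ?_))
    exact (congrFun (hall (i + 1)).2 ⟨i, Nat.lt_succ_self i⟩).symm
  refine (h.frequently (max c.1 d.1 + 1) n
    (fun j s => if j = c.1 ∧ s = digits n c.2 then A else B) fun j s => ?_).mono fun m hm => ⟨?_, ?_⟩
  · split_ifs
    exacts [⟨hA, hA'⟩, ⟨hB, hB'⟩]
  · simpa using hm c.1 (Nat.lt_succ_of_le (le_max_left _ _)) c.2
  · simpa only [if_neg hn] using hm d.1 (Nat.lt_succ_of_le (le_max_right _ _)) d.2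

/-- Equal images could not be carried to disjoint open sets at the same time. -/
theorem injective [Nontrivial X] (h : IsGenericFamily f φ M) :
    Function.Injective fun c : ℕ × (ℕ → Bool) => φ c.1 c.2 := by
  intro c d hcd
  by_contra hne
  obtain ⟨x, y, hxy⟩ := exists_pair_ne X
  obtain ⟨A, B, hA, hB, hx, hy, hAB⟩ := t2_separation hxy
  obtain ⟨m, hmA, hmB⟩ := (h.frequently_pair hne hA ⟨x, hx⟩ hB ⟨y, hy⟩).exists
  dsimp only at hcd
  rw [← hcd] at hmB
  exact disjoint_left.1 hAB hmA hmB

theorem isCantorSet_range [Nontrivial X] (h : IsGenericFamily f φ M) (j : ℕ) :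
    IsCantorSet (range (φ j)) :=
  TopDyn.isCantorSet_range (φ j).continuous fun t t' ht =>
    (Prod.ext_iff.1 (h.injective (a₁ := (j, t)) (a₂ := (j, t')) ht)).2

theorem disjoint_range [Nontrivial X] (h : IsGenericFamily f φ M) {i j : ℕ} (hij : i ≠ j) :
    Disjoint (range (φ i)) (range (φ j)) := by
  rw [disjoint_left]
  rintro _ ⟨t, rfl⟩ ⟨t', ht⟩
  exact hij (Prod.ext_iff.1 (h.injective (a₁ := (i, t)) (a₂ := (j, t')) ht.symm)).1

theorem frequently_pair_of_ne (h : IsGenericFamily f φ M) {c d : X}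
    (hc : c ∈ ⋃ j, range (φ j)) (hd : d ∈ ⋃ j, range (φ j)) (hcd : c ≠ d)
    {A B : Set X} (hA : IsOpen A) (hA' : A.Nonempty) (hB : IsOpen B) (hB' : B.Nonempty) :
    ∃ᶠ m in atTop ⊓ 𝓟 M, f^[m] c ∈ A ∧ f^[m] d ∈ B := by
  obtain ⟨j, t, rfl⟩ := mem_iUnion.1 hc
  obtain ⟨j', t', rfl⟩ := mem_iUnion.1 hd
  exact h.frequently_pair (c := (j, t)) (d := (j', t'))
    (fun heq => hcd (congrArg (fun e : ℕ × (ℕ → Bool) => φ e.1 e.2) heq)) hA hA' hB hB'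

/-- Any two points of the family are simultaneously carried to a given open set. -/
theorem frequently_both_mem (h : IsGenericFamily f φ M) {c d : X}
    (hc : c ∈ ⋃ j, range (φ j)) (hd : d ∈ ⋃ j, range (φ j)) {A : Set X} (hA : IsOpen A)
    (hA' : A.Nonempty) : ∃ᶠ m in atTop ⊓ 𝓟 M, f^[m] c ∈ A ∧ f^[m] d ∈ A := by
  obtain ⟨j, t, rfl⟩ := mem_iUnion.1 hc
  obtain ⟨j', t', rfl⟩ := mem_iUnion.1 hd
  exact (h.frequently_forall_mem (max j j' + 1) hA hA').mono fun m hm =>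
    ⟨hm j (Nat.lt_succ_of_le (le_max_left _ _)) t, hm j' (Nat.lt_succ_of_le (le_max_right _ _)) t'⟩

/-- Since `n` divides almost all times in `M`, what happens often along `M` happens often for the
`n`-th iterate. -/
theorem frequently_mul (h : IsGenericFamily f φ M) {n : ℕ} (hn : 1 ≤ n) {p : ℕ → Prop}
    (hp : ∃ᶠ m in atTop ⊓ 𝓟 M, p m) : ∃ᶠ k in atTop, p (n * k) := by
  rw [frequently_atTop]
  intro a
  obtain ⟨N, hN⟩ := h.factorial_dvd n hn
  obtain ⟨m, hm, hmM, hpm⟩ := frequently_atTop_inf_principal.1 hp (max N (n * a))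
  obtain ⟨k, rfl⟩ := (Nat.dvd_factorial hn le_rfl).trans (hN m hmM ((le_max_left _ _).trans hm))
  exact ⟨k, Nat.le_of_mul_le_mul_left ((le_max_right _ _).trans hm) hn, hpm⟩

theorem isTotallyTransitivePoint (h : IsGenericFamily f φ M) {c : X}
    (hc : c ∈ ⋃ j, range (φ j)) : IsTotallyTransitivePoint f c := by
  intro n hn
  rw [IsTransitivePoint, dense_iff_inter_open]
  intro U hU hU'
  obtain ⟨k, hk, -⟩ := (h.frequently_mul hn (h.frequently_both_mem hc hc hU hU')).exists
  exact ⟨_, hk, k, by rw [Function.iterate_mul]⟩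

theorem isSyncProximalWrt (h : IsGenericFamily f φ M) (l : ℕ) (v : X) :
    IsSyncProximalWrt f M (⋃ (j : ℕ) (_ : j ≤ l), range (φ j)) v := by
  refine exists_strictMono_tendsto_ediam (p := fun m => 0 < m ∧ m ∈ M)
    (D := fun m => f^[m] '' (⋃ (j : ℕ) (_ : j ≤ l), range (φ j)) ∪ {v}) fun ε hε => ?_
  refine (frequently_inf_principal.1 (h.frequently_forall_edist_lt (l + 1) v hε)).mono ?_
  rintro m ⟨hm, hlt⟩
  refine ⟨⟨h.pos m hm, hm⟩, ediam_le_two_mul (v := v) ?_⟩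
  rintro y (⟨c, hc, rfl⟩ | rfl)
  · obtain ⟨j, hj, t, rfl⟩ := mem_iUnion₂.1 hc
    exact (hlt j (Nat.lt_succ_of_le hj) t).le
  · simp

theorem frequently_edist_lt [Nonempty X] (h : IsGenericFamily f φ M) {c d : X}
    (hc : c ∈ ⋃ j, range (φ j)) (hd : d ∈ ⋃ j, range (φ j)) {ε : ℝ≥0∞} (hε : 0 < ε) :
    ∃ᶠ m in atTop ⊓ 𝓟 M, edist (f^[m] c) (f^[m] d) < ε := by
  have hε' : 0 < ε / 2 := ENNReal.half_pos hε.ne'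
  refine (h.frequently_both_mem hc hd Metric.isOpen_eball
    ⟨Classical.arbitrary X, Metric.mem_eball_self hε'⟩).mono fun m hm => ?_
  calc edist (f^[m] c) (f^[m] d) ≤ _ := edist_triangle_right _ _ (Classical.arbitrary X)
    _ < ε / 2 + ε / 2 := ENNReal.add_lt_add hm.1 hm.2
    _ = ε := ENNReal.add_halves ε

/-- Distinct points of the family, shifted along their orbits, are often far apart. -/
theorem frequently_lt_edist (hf : Continuous f) (hmix : IsWeaklyMixing f)
    (h : IsGenericFamily f φ M) {c d : X}
    (hc : c ∈ ⋃ j, range (φ j)) (hd : d ∈ ⋃ j, range (φ j)) (hcd : c ≠ d) (i j : ℕ) {b : ℝ≥0∞}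
    (hb : b < spaceDiam X) :
    ∃ᶠ m in atTop ⊓ 𝓟 M, b < edist (f^[m] (f^[i] c)) (f^[m] (f^[j] d)) := by
  obtain ⟨A, B, hA, hA', hB, hB', hAB⟩ := exists_isOpen_pair_lt_edist hb
  -- Aiming at preimages under `f^[i]` and `f^[j]` absorbs the shifts, because iterates commute.
  refine (h.frequently_pair_of_ne hc hd hcd (hA.preimage (hf.iterate i))
    (hmix.nonempty_preimage hf i hA hA') (hB.preimage (hf.iterate j))
    (hmix.nonempty_preimage hf j hB hB')).mono fun m hm => ?_
  rw [((Function.Commute.refl f).iterate_iterate m i).eq,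
    ((Function.Commute.refl f).iterate_iterate m j).eq]
  exact hAB _ hm.1 _ hm.2

/-- The two points move together, so the target is the open set where `f^[l]` displaces points by
more than `b`. -/
theorem frequently_lt_edist_same (hf : Continuous f) (hmix : IsWeaklyMixing f)
    (h : IsGenericFamily f φ M) {c : X} (hc : c ∈ ⋃ j, range (φ j)) (i l : ℕ) {b : ℝ≥0∞}
    (hb : b < ⨆ x, edist (f^[l] x) x) :
    ∃ᶠ m in atTop ⊓ 𝓟 M, b < edist (f^[m] (f^[l] (f^[i] c))) (f^[m] (f^[i] c)) := by
  obtain ⟨x, hx⟩ := lt_iSup_iff.1 hb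
  have ho : IsOpen {y | b < edist (f^[l] y) y} :=
    isOpen_lt continuous_const ((hf.iterate l).edist continuous_id)
  refine (h.frequently_both_mem hc hc (ho.preimage (hf.iterate i))
    (hmix.nonempty_preimage hf i ho ⟨x, hx⟩)).mono fun m hm => ?_
  rw [((Function.Commute.refl f).iterate_iterate m l).eq,
    ((Function.Commute.refl f).iterate_iterate m i).eq]
  exact hm.1

/-- For shifts of distinct points `r` is the diameter. For two shifts of one point, `l ≥ 1` apart,
it is the supremal displacement of `f^[l]`, positive because the shifts differ. -/
theorem exists_frequently_lt_edist [Nontrivial X] (hf : Continuous f) (hmix : IsWeaklyMixing f)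
    (h : IsGenericFamily f φ M) {c d : X} (hc : c ∈ forwardUnion f (⋃ j, range (φ j)))
    (hd : d ∈ forwardUnion f (⋃ j, range (φ j))) (hcd : c ≠ d) :
    ∃ r, 0 < r ∧ rigidityConst f ≤ r ∧
      ∀ b < r, ∃ᶠ m in atTop ⊓ 𝓟 M, b < edist (f^[m] c) (f^[m] d) := by
  obtain ⟨i, c, hc', rfl⟩ := mem_iUnion.1 hc
  obtain ⟨j, d, hd', rfl⟩ := mem_iUnion.1 hd
  by_cases hcd' : c = d
  · subst hcd'
    wlog hij : j ≤ i generalizing i j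
    · obtain ⟨r, hr, hr', hb⟩ := this j hd i hc hcd.symm (le_of_not_ge hij)
      exact ⟨r, hr, hr', fun b hbr => by simpa only [edist_comm] using hb b hbr⟩
    obtain ⟨l, rfl⟩ := Nat.exists_eq_add_of_le' hij
    rw [Function.iterate_add_apply] at hcd ⊢
    refine ⟨⨆ x, edist (f^[l] x) x,
      (edist_pos.2 hcd).trans_le (le_iSup (fun x => edist (f^[l] x) x) (f^[j] c)),
      iInf₂_le l (Nat.one_le_iff_ne_zero.2 ?_),
      fun b hb => h.frequently_lt_edist_same hf hmix hc' j l hb⟩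
    rintro rfl
    exact hcd rfl
  · exact ⟨spaceDiam X, spaceDiam_pos, rigidityConst_le_spaceDiam f,
      fun b hb => h.frequently_lt_edist hf hmix hc' hd' hcd' i j hb⟩

/-- The preimages of a ball about `z` under `f^[i]` and `f^[j]` both contain `z`, so their
intersection is a legitimate common target. -/
theorem frequently_edist_lt_of_isFixedPt (hf : Continuous f) (h : IsGenericFamily f φ M) {z : X}
    (hz : f z = z) {c d : X} (hc : c ∈ forwardUnion f (⋃ j, range (φ j)))
    (hd : d ∈ forwardUnion f (⋃ j, range (φ j))) {ε : ℝ≥0∞} (hε : 0 < ε) :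
    ∃ᶠ m in atTop ⊓ 𝓟 M, edist (f^[m] c) (f^[m] d) < ε := by
  obtain ⟨i, c, hc', rfl⟩ := mem_iUnion.1 hc
  obtain ⟨j, d, hd', rfl⟩ := mem_iUnion.1 hd
  have hε' : 0 < ε / 2 := ENNReal.half_pos hε.ne'
  have hmem : ∀ n, z ∈ f^[n] ⁻¹' Metric.eball z (ε / 2) := fun n => by
    rw [mem_preimage, Function.iterate_fixed hz]
    exact Metric.mem_eball_self hε'
  have ho : ∀ n, IsOpen (f^[n] ⁻¹' Metric.eball z (ε / 2)) := fun n =>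
    Metric.isOpen_eball.preimage (hf.iterate n)
  refine (h.frequently_both_mem hc' hd' ((ho i).inter (ho j)) ⟨z, hmem i, hmem j⟩).mono
    fun m hm => ?_
  rw [((Function.Commute.refl f).iterate_iterate m i).eq,
    ((Function.Commute.refl f).iterate_iterate m j).eq]
  calc edist (f^[i] (f^[m] c)) (f^[j] (f^[m] d)) ≤ _ := edist_triangle_right _ _ z
    _ < ε / 2 + ε / 2 := ENNReal.add_lt_add hm.1.1 hm.2.2
    _ = ε := ENNReal.add_halves ε

end IsGenericFamily

end Metric

/-! ### Forward unions and relatively compact orbits -/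

theorem mapsTo_forwardUnion {X : Type*} (f : X → X) (A : Set X) (n : ℕ) :
    MapsTo (f^[n]) (forwardUnion f A) (forwardUnion f A) := by
  intro c hc
  obtain ⟨i, c, hc', rfl⟩ := mem_iUnion.1 hc
  exact mem_iUnion.2 ⟨n + i, c, hc', Function.iterate_add_apply f n i c⟩

theorem subset_forwardUnion {X : Type*} (f : X → X) (A : Set X) : A ⊆ forwardUnion f A :=
  fun c hc => mem_iUnion.2 ⟨0, c, hc, rfl⟩

theorem iterate_mem_closure_orbit {X : Type*} [TopologicalSpace X] (f : X → X) (x : X) (n : ℕ) :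
    f^[n] x ∈ closure (orbit f x) :=
  subset_closure ⟨n, rfl⟩

/-- A generic family, which moreover is proximal to, and far from, the orbits of countably many
points with relatively compact orbits. -/
theorem exists_isGenericFamily_forall_orbit {X : Type*} [MetricSpace X] [Nonempty X]
    [LocallyCompactSpace X] [TopologicalSpace.SeparableSpace X] {f : X → X} (hf : Continuous f)
    (hmix : IsWeaklyMixing f) {P : Set X} (hP : P.Countable)
    (hPcpt : ∀ x ∈ P, IsCompact (closure (orbit f x))) :
    ∃ φ M, IsGenericFamily f φ M ∧
      (∀ O : Set X, IsOpen O → O.Nonempty → {j | range (φ j) ⊆ O}.Infinite) ∧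
      ∀ x ∈ P, ∀ i j L : ℕ,
        (∀ ε > 0, ∃ᶠ n in atTop, ∀ a < L, ∀ t,
          edist (f^[n] (f^[i] x)) (f^[n] (f^[j] (φ a t))) < ε) ∧
        ∀ b < spaceDiam X / 2, ∃ᶠ n in atTop, ∀ a < L, ∀ t,
          b ≤ edist (f^[n] (f^[i] x)) (f^[n] (f^[j] (φ a t))) := by
  have := UniformSpace.secondCountable_of_separable X
  have := hP.to_subtype
  choose S hfin hopen hnear hfar using fun x : P => exists_selectors (hPcpt x x.2)
  obtain ⟨φ, M, hM, hO, hσ⟩ := exists_isGenericFamily_forall_selector hf hmix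
    (ι := P × ℕ × ℕ × (ℕ ⊕ (TopologicalSpace.countableBasis X × TopologicalSpace.countableBasis X)))
    -- For `q = (x, i, j, τ)` the target at time `m = n + j` is chosen relative to `f^[n] (f^[i]
    -- x)`, and so compares it with `f^[n] (f^[j] (φ a t))`. The truncated subtraction is harmless,
    -- since only `m > N + j` is used.
    (fun q m => S q.1 q.2.2.2 (f^[m - q.2.2.1] (f^[q.2.1] q.1)))
    (fun q => (hfin q.1 q.2.2.2).subset (range_subset_iff.2 fun m => mem_range_self _))
    (fun q m => hopen q.1 q.2.2.2 _)
  have hfreq : ∀ (x : P) (i j L : ℕ) (τ), ∃ᶠ n in atTop, ∀ a < L, ∀ t,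
      f^[n] (f^[j] (φ a t)) ∈ S x τ (f^[n] (f^[i] x)) := by
    intro x i j L τ
    rw [frequently_atTop]
    intro N
    obtain ⟨m, hm, h⟩ := hσ (x, i, j, τ) L (N + j)
    refine ⟨m - j, by omega, fun a ha t => ?_⟩
    rw [← Function.iterate_add_apply f (m - j) j, Nat.sub_add_cancel (by omega)]
    exact h a ha t
  refine ⟨φ, M, hM, hO, fun x hx i j L => ⟨fun ε hε => ?_, fun b hb => ?_⟩⟩
  · obtain ⟨τ, hτ⟩ := hnear ⟨x, hx⟩ ε hε
    refine (hfreq ⟨x, hx⟩ i j L τ).mono fun n hn a ha t => hτ _ ?_ _ (hn a ha t)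
    rw [← Function.iterate_add_apply]
    exact iterate_mem_closure_orbit f x _
  · obtain ⟨τ, hτ⟩ := hfar ⟨x, hx⟩ b hb
    exact (hfreq ⟨x, hx⟩ i j L τ).mono fun n hn a ha t => hτ _ _ (hn a ha t)

/-! ### Scrambled sets -/

namespace IsGenericFamily

variable {X : Type*} [MetricSpace X] {f : X → X} {φ : ℕ → C(ℕ → Bool, X)} {M : Set ℕ}

theorem nontrivial_iUnion_range [Nontrivial X] (h : IsGenericFamily f φ M) :
    (⋃ j, range (φ j)).Nontrivial := by
  refine ⟨_, mem_iUnion.2 ⟨0, mem_range_self fun _ => false⟩, _,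
    mem_iUnion.2 ⟨1, mem_range_self fun _ => false⟩, fun heq => ?_⟩
  have := h.injective (a₁ := (0, fun _ => false)) (a₂ := (1, fun _ => false)) heq
  simp at this

theorem isScrambledSetWrt [Nontrivial X] (hf : Continuous f) (hmix : IsWeaklyMixing f)
    (h : IsGenericFamily f φ M) : IsScrambledSetWrt f M (spaceDiam X) (⋃ j, range (φ j)) :=
  ⟨spaceDiam_pos, h.nontrivial_iUnion_range, fun _ hc _ hd hcd =>
    ⟨liminf_eq_zero_of_frequently_lt fun _ hε => h.frequently_edist_lt hc hd hε,
    le_limsup_of_forall_frequently_le fun _ hb =>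
      (h.frequently_lt_edist hf hmix hc hd hcd 0 0 hb).mono fun _ hm => hm.le⟩⟩

theorem isScrambledSet_iterate [Nontrivial X] (hf : Continuous f) (hmix : IsWeaklyMixing f)
    (h : IsGenericFamily f φ M) {n : ℕ} (hn : 1 ≤ n) :
    IsScrambledSet (f^[n]) (spaceDiam X) (⋃ j, range (φ j)) := by
  refine ⟨spaceDiam_pos, h.nontrivial_iUnion_range, fun c hc d hd hcd => ?_⟩
  simp only [← Function.iterate_mul]
  exact ⟨liminf_eq_zero_of_frequently_lt fun _ hε =>
      h.frequently_mul hn (h.frequently_edist_lt hc hd hε),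
    le_limsup_of_forall_frequently_le fun _ hb =>
      (h.frequently_mul hn (h.frequently_lt_edist hf hmix hc hd hcd 0 0 hb)).mono fun _ hm => hm.le⟩

theorem forwardUnion_iterate [Nontrivial X] (hf : Continuous f) (hmix : IsWeaklyMixing f)
    (h : IsGenericFamily f φ M) {z : X} (hz : f z = z) {n : ℕ} (hn : 1 ≤ n) {c d : X}
    (hc : c ∈ forwardUnion f (⋃ j, range (φ j))) (hd : d ∈ forwardUnion f (⋃ j, range (φ j)))
    (hcd : c ≠ d) :
    liminf (fun k : ℕ => edist ((f^[n])^[k] c) ((f^[n])^[k] d)) atTop = 0 ∧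
    0 < limsup (fun k : ℕ => edist ((f^[n])^[k] c) ((f^[n])^[k] d)) atTop ∧
    rigidityConst f ≤ limsup (fun k : ℕ => edist ((f^[n])^[k] c) ((f^[n])^[k] d)) atTop := by
  obtain ⟨r, hr, hr', hb⟩ := h.exists_frequently_lt_edist hf hmix hc hd hcd
  simp only [← Function.iterate_mul]
  have hle : r ≤ limsup (fun k : ℕ => edist (f^[n * k] c) (f^[n * k] d)) atTop :=
    le_limsup_of_forall_frequently_le fun b hbr =>
      (h.frequently_mul hn (hb b hbr)).mono fun _ hm => hm.le
  exact ⟨liminf_eq_zero_of_frequently_lt fun _ hε =>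
    h.frequently_mul hn (h.frequently_edist_lt_of_isFixedPt hf hz hc hd hε),
    hr.trans_le hle, hr'.trans hle⟩

end IsGenericFamily

end TopDyn

/-! ### The main theorem -/

theorem theorem19 {X : Type*} [MetricSpace X] [Infinite X] [TopologicalSpace.SeparableSpace X]
    [LocallyCompactSpace X] (f : X → X) (hf : Continuous f) (hmix : IsWeaklyMixing f)
    (V : Set X) (hV : V.Countable)
    (P : Set X) (hP : P.Countable) (hPcpt : ∀ x ∈ P, IsCompact (closure (orbit f x))) :
    (∀ x : X, ¬ IsOpen ({x} : Set X)) ∧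
    ∃ (M : Set ℕ) (S : ℕ → Set X),
      -- `M` is an infinite set of positive integers, and each `n!` divides its large elements
      M.Infinite ∧ (∀ m ∈ M, 0 < m) ∧
      (∀ n : ℕ, 1 ≤ n → ∃ N : ℕ, ∀ m ∈ M, N ≤ m → n.factorial ∣ m) ∧
      -- the `S j` are pairwise disjoint Cantor sets of totally transitive points
      (∀ j, IsCantorSet (S j)) ∧ (∀ i j, i ≠ j → Disjoint (S i) (S j)) ∧
      (∀ j, ∀ x ∈ S j, IsTotallyTransitivePoint f x) ∧
      -- (1)
      (∀ U : Set X, IsOpen U → U.Nonempty → {j : ℕ | S j ⊆ U}.Infinite) ∧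
      -- (2), where the finite unions are over `0 ≤ j ≤ l`
      (∀ l : ℕ,
        (∀ v ∈ V, IsSyncProximalWrt f M (⋃ (j : ℕ) (_ : j ≤ l), S j) v) ∧
        (∀ x ∈ P, ∀ i : ℕ, IsDynSyncProximal f (⋃ (j : ℕ) (_ : j ≤ l), S j) (f^[i] x))) ∧
      -- (3)
      (Dense (⋃ j, S j) ∧ IsScrambledSetWrt f M (spaceDiam X) (⋃ j, S j) ∧
        ∀ n : ℕ, 1 ≤ n → IsScrambledSet (f^[n]) (spaceDiam X) (⋃ j, S j)) ∧
      -- (4)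
      (∀ x ∈ forwardUnion f P, ∀ c ∈ forwardUnion f (⋃ j, S j),
        liminf (fun n : ℕ => edist (f^[n] x) (f^[n] c)) atTop = 0 ∧
        spaceDiam X / 2 ≤ limsup (fun n : ℕ => edist (f^[n] x) (f^[n] c)) atTop ∧
        IsScrambledSet f (spaceDiam X / 2) {x, c}) ∧
      -- (5)
      (∀ c ∈ ⋃ j, S j, ∀ d ∈ ⋃ j, S j, c ≠ d → ∀ i : ℕ,
        limsup (fun n : ℕ => edist (f^[n] (f^[i] c)) (f^[n] (f^[i] d))) (atTop ⊓ 𝓟 M)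
          = spaceDiam X) ∧
      -- (6)
      ((∃ z : X, f z = z) →
        Dense (forwardUnion f (⋃ j, S j)) ∧
        MapsTo f (forwardUnion f (⋃ j, S j)) (forwardUnion f (⋃ j, S j)) ∧
        ∀ n : ℕ, 1 ≤ n →
          MapsTo (f^[n]) (forwardUnion f (⋃ j, S j)) (forwardUnion f (⋃ j, S j)) ∧
          IsLiYorkeScrambledSet (f^[n]) (forwardUnion f (⋃ j, S j))) ∧
      -- (7)
      ((∃ z : X, f z = z) → 0 < rigidityConst f →
        Dense (forwardUnion f (⋃ j, S j)) ∧
        MapsTo f (forwardUnion f (⋃ j, S j)) (forwardUnion f (⋃ j, S j)) ∧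
        ∀ n : ℕ, 1 ≤ n →
          MapsTo (f^[n]) (forwardUnion f (⋃ j, S j)) (forwardUnion f (⋃ j, S j)) ∧
          IsScrambledSet (f^[n]) (rigidityConst f) (forwardUnion f (⋃ j, S j))) := by
  obtain ⟨φ, M, hM, hO, hP'⟩ := exists_isGenericFamily_forall_orbit hf hmix hP hPcpt
  have hdense : Dense (⋃ j, range (φ j)) := by
    rw [dense_iff_inter_open]
    intro U hU hU'
    obtain ⟨j, hj⟩ := (hO U hU hU').nonempty
    exact ⟨φ j fun _ => false, hj (mem_range_self _), mem_iUnion.2 ⟨j, mem_range_self _⟩⟩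
  have hdense' : Dense (forwardUnion f (⋃ j, range (φ j))) :=
    hdense.mono (subset_forwardUnion f _)
  have hnontriv : (forwardUnion f (⋃ j, range (φ j))).Nontrivial :=
    hM.nontrivial_iUnion_range.mono (subset_forwardUnion f _)
  refine ⟨hmix.not_isOpen_singleton, M, fun j => range (φ j), hM.infinite, hM.pos,
    hM.factorial_dvd, hM.isCantorSet_range, fun i j => hM.disjoint_range,
    fun j c hc => hM.isTotallyTransitivePoint (mem_iUnion.2 ⟨j, hc⟩), hO,
    fun l => ⟨fun v _ => hM.isSyncProximalWrt l v, fun x hx i => ?_⟩,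
    ⟨hdense, hM.isScrambledSetWrt hf hmix, fun n => hM.isScrambledSet_iterate hf hmix⟩,
    ?_, ?_, ?_, ?_⟩
  · refine exists_strictMono_tendsto_ediam (p := fun m => 0 < m)
      (D := fun m => f^[m] '' ((⋃ (j : ℕ) (_ : j ≤ l), range (φ j)) ∪ {f^[i] x})) fun ε hε => ?_
    refine (((hP' x hx i 0 (l + 1)).1 ε hε).and_eventually (eventually_gt_atTop 0)).mono ?_
    rintro m ⟨hlt, hm⟩
    refine ⟨hm, ediam_le_two_mul (v := f^[m] (f^[i] x)) ?_⟩
    rintro _ ⟨c, hc | rfl, rfl⟩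
    · obtain ⟨j, hj, t, rfl⟩ := mem_iUnion₂.1 hc
      rw [edist_comm]
      exact (hlt j (Nat.lt_succ_of_le hj) t).le
    · simp
  · intro y hy c hc
    obtain ⟨i, x, hx, rfl⟩ := mem_iUnion.1 hy
    obtain ⟨j, c, hc', rfl⟩ := mem_iUnion.1 hc
    obtain ⟨a, t, rfl⟩ := mem_iUnion.1 hc'
    have hinf : liminf (fun n : ℕ => edist (f^[n] (f^[i] x)) (f^[n] (f^[j] (φ a t)))) atTop = 0 :=
      liminf_eq_zero_of_frequently_lt fun ε hε =>
        ((hP' x hx i j (a + 1)).1 ε hε).mono fun n hn => hn a (Nat.lt_succ_self a) t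
    have hsup : spaceDiam X / 2 ≤
        limsup (fun n : ℕ => edist (f^[n] (f^[i] x)) (f^[n] (f^[j] (φ a t)))) atTop :=
      le_limsup_of_forall_frequently_le fun b hb =>
        ((hP' x hx i j (a + 1)).2 b hb).mono fun n hn => hn a (Nat.lt_succ_self a) t
    have hpos : 0 < spaceDiam X / 2 := ENNReal.half_pos spaceDiam_pos.ne'
    -- The points are distinct: otherwise the upper limit would be `0`, below `spaceDiam X / 2`.
    refine ⟨hinf, hsup, hpos, nontrivial_pair fun heq => ?_, ?_⟩
    · rw [heq] at hsup
      simp only [edist_self, limsup_const] at hsup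
      exact hpos.not_ge hsup
    · rintro p (rfl | rfl) q (rfl | rfl) hpq
      · exact absurd rfl hpq
      · exact ⟨hinf, hsup⟩
      · simp only [edist_comm (f^[_] (f^[j] (φ a t)))]
        exact ⟨hinf, hsup⟩
      · exact absurd rfl hpq
  · intro c hc d hd hcd i
    refine le_antisymm ?_ (le_limsup_of_forall_frequently_le fun b hb =>
      (hM.frequently_lt_edist hf hmix hc hd hcd i i hb).mono fun _ hm => hm.le)
    exact limsup_le_of_le (h := Eventually.of_forall fun n => edist_le_spaceDiam _ _)
  · rintro ⟨z, hz⟩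
    refine ⟨hdense', mapsTo_forwardUnion f _ 1, fun n hn => ⟨mapsTo_forwardUnion f _ n, hnontriv,
      fun c hc d hd hcd => ?_⟩⟩
    obtain ⟨h₁, h₂, -⟩ := hM.forwardUnion_iterate hf hmix hz hn hc hd hcd
    exact ⟨h₁, h₂⟩
  · rintro ⟨z, hz⟩ hδ
    refine ⟨hdense', mapsTo_forwardUnion f _ 1, fun n hn => ⟨mapsTo_forwardUnion f _ n, hδ, hnontriv,
      fun c hc d hd hcd => ?_⟩⟩
    obtain ⟨h₁, -, h₃⟩ := hM.forwardUnion_iterate hf hmix hz hn hc hd hcd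
    exact ⟨h₁, h₃⟩
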